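/- Let $\mathfrak h$ be a finite-dimensional complex Lie algebra, and let $\mathcal C^\bullet\mathfrak h=(\bigwedge^\bullet\mathfrak h^*,d)$ be its Chevalley--Eilenberg cochain algebra, where $d$ is the graded derivation of degree $1$ with $(d\eta)(x,y)=-\eta([x,y])$ for $\eta\in\mathfrak h^*$, $x,y\in\mathfrak h$. For a connected, finite-dimensional commutative differential graded algebra $A$ over $\mathbb C$ and a finite-dimensional complex Lie algebra $\mathfrak g$, let $$\mathcal F(A,\mathfrak g)=\{\omega\in A^1\otimes\mathfrak g\mid d\omega+\tfrac12[\omega,\omega]=0\}$$ be the variety of $\mathfrak g$-valued flat connections on $A$, where $[a\otimes x,b\otimes y]=ab\otimes[x,y]$, and let $$\mathcal F^1(A,\mathfrak g)=\{\eta\otimes x\mid \eta\in A^1,\ d\eta=0,\ x\in\mathfrak g\}\subseteq\mathcal F(A,\mathfrak g)$$ be its rank one part. Then the germs at $0$ of these two sets agree for $A=\mathcal C^\bullet\mathfrak h$ and $\mathfrak g=\mathfrak{sl}_2(\mathbb C)$: $$\mathcal F(\mathcal C^\bullet\mathfrak h,\mathfrak{sl}_2)_{(0)}=\mathcal F^1(\mathcal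 C^\bullet\mathfrak h,\mathfrak{sl}_2)_{(0)},$$ that is, the two sets coincide in some neighbourhood of $0$ in the finite-dimensional complex vector space $\mathfrak h^*\otimes\mathfrak{sl}_2$ with its usual topology. Equivalently, in $\operatorname{Hom}_{\mathbb C}(\mathfrak h,\mathfrak{sl}_2)$ the set of all Lie algebra homomorphisms $\mathfrak h\to\mathfrak{sl}_2$ and its subset of Lie algebra homomorphisms of rank at most $1$ have the same germ at $0$: there is a neighbourhood of $0$ in which every Lie algebra homomorphism $\mathfrak h\to\mathfrak{sl}_2$ has rank at most $1$. -/

import Mathlib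

open scoped TensorProduct

universe u v

/-- A connected, finite-dimensional commutative differential graded algebra over `ℂ`:
a graded `ℂ`-algebra `A = ⨁ₙ Aⁿ`, commutative in the graded sense, with a differential `d` of
degree `1` satisfying the graded Leibniz rule, such that `A⁰ = ℂ · 1` and `dim A < ∞`. -/
structure CDGA where
  carrier : Type u
  [ring : Ring carrier]
  [algebra : Algebra ℂ carrier]
  [nontrivial : Nontrivial carrier]
  [finite : Module.Finite ℂ carrier]
  /-- `grading n` is the homogeneous part `Aⁿ`. -/
  grading : ℕ → Submodule ℂ carrier
  [graded : GradedAlgebra grading]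
  graded_comm : ∀ {i j : ℕ} {a b : carrier}, a ∈ grading i → b ∈ grading j →
    a * b = (-1) ^ (i * j) * (b * a)
  /-- The differential. -/
  d : carrier →ₗ[ℂ] carrier
  d_mem : ∀ {i : ℕ} {a : carrier}, a ∈ grading i → d a ∈ grading (i + 1)
  d_d : ∀ a : carrier, d (d a) = 0
  leibniz : ∀ {i : ℕ} {a : carrier} (b : carrier), a ∈ grading i →
    d (a * b) = d a * b + (-1) ^ i * (a * d b)
  /-- Connectedness: `A⁰ = ℂ · 1`. -/
  connected : grading 0 = ℂ ∙ (1 : carrier)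

attribute [instance] CDGA.ring CDGA.algebra CDGA.nontrivial CDGA.finite CDGA.graded

namespace CDGA

variable (A : CDGA.{u}) (g : Type v) [LieRing g] [LieAlgebra ℂ g]

/-- The bilinear bracket on `A ⊗ g`, given by `[a ⊗ x, b ⊗ y] = (a b) ⊗ [x, y]`. -/
noncomputable def bracket :
    A.carrier ⊗[ℂ] g →ₗ[ℂ] A.carrier ⊗[ℂ] g →ₗ[ℂ] A.carrier ⊗[ℂ] g :=
  TensorProduct.map₂ (LinearMap.mul ℂ A.carrier) (LieModule.toEnd ℂ g g : g →ₗ[ℂ] Module.End ℂ g)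

/-- The inclusion `A¹ ⊗ g → A ⊗ g`. -/
noncomputable def incl : A.grading 1 ⊗[ℂ] g →ₗ[ℂ] A.carrier ⊗[ℂ] g :=
  (A.grading 1).subtype.rTensor g

/-- The variety `F(A, g) ⊆ A¹ ⊗ g` of `g`-valued flat connections on `A`, given by the
Maurer-Cartan equation `dω + ½ [ω, ω] = 0`. -/
def flatConnections : Set (A.grading 1 ⊗[ℂ] g) :=
  {ω | A.d.rTensor g (A.incl g ω) +
    (1 / 2 : ℂ) • A.bracket g (A.incl g ω) (A.incl g ω) = 0}

/-- The rank one part `F¹(A, g)`, consisting of the elements `η ⊗ x` with `η ∈ H¹(A)` and `x ∈ g`.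
As `A` is connected, `d` vanishes on `A⁰` and `H¹(A) = {η ∈ A¹ | dη = 0}`. -/
def flatConnectionsRankOne : Set (A.grading 1 ⊗[ℂ] g) :=
  {ω | ∃ (η : A.grading 1) (x : g), A.d (η : A.carrier) = 0 ∧ ω = η ⊗ₜ[ℂ] x}

end CDGA

/-- The germ at `0` of a subset of a finite-dimensional complex vector space `M` with its usual
topology: the class of `X` modulo the relation identifying `X` and `Y` when `X ∩ U = Y ∩ U`
for some neighbourhood `U` of `0`. -/
noncomputable def germAtZero {M : Type v} [AddCommGroup M] [Module ℂ M] (X : Set M) :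
    (@nhds M (moduleTopology ℂ M) 0).Germ Prop :=
  Filter.Germ.ofFun fun m => m ∈ X

namespace ChevalleyEilenberg

variable (h : Type u) [LieRing h] [LieAlgebra ℂ h]

/-- The exterior algebra on the dual vector space of `h`. -/
abbrev Cochains : Type u := ExteriorAlgebra ℂ (Module.Dual ℂ h)

/-- The grade involution, equal to `(-1) ^ n` in degree `n`. -/
noncomputable def invol : Cochains h →ₐ[ℂ] Cochains h :=
  ExteriorAlgebra.map (-LinearMap.id)

lemma invol_mem {i : ℕ} {a : Cochains h} (ha : a ∈ ⋀[ℂ]^i (Module.Dual ℂ h)) :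
    invol h a = (-1) ^ i * a := by
  induction ha using Submodule.pow_induction_on_left' with
  | algebraMap r => simp
  | add x y i hx hy ihx ihy => rw [map_add, ihx, ihy, mul_add]
  | mem_mul m hm i x hx ih =>
    obtain ⟨v, rfl⟩ := hm
    rw [map_mul, ih, invol, ExteriorAlgebra.map_apply_ι, pow_succ]
    rcases neg_one_pow_eq_or (Cochains h) i with h1 | h1 <;> rw [h1] <;> simp

lemma ι_mul_comm {j : ℕ} {b : Cochains h} (hb : b ∈ ⋀[ℂ]^j (Module.Dual ℂ h))
    (v : Module.Dual ℂ h) :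
    ExteriorAlgebra.ι ℂ v * b = (-1) ^ j * (b * ExteriorAlgebra.ι ℂ v) := by
  induction hb using Submodule.pow_induction_on_left' with
  | algebraMap r => simp [Algebra.commutes]
  | add x y i hx hy ihx ihy => rw [mul_add, ihx, ihy, add_mul, mul_add]
  | mem_mul m hm i x hx ih =>
    obtain ⟨w, rfl⟩ := hm
    have hvw := eq_neg_of_add_eq_zero_left (ExteriorAlgebra.ι_add_mul_swap (R := ℂ) v w)
    rw [← mul_assoc, hvw, neg_mul, mul_assoc, ih, pow_succ]
    rcases neg_one_pow_eq_or (Cochains h) i with h1 | h1 <;> rw [h1] <;> simp [mul_assoc]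

lemma graded_comm {i j : ℕ} {a b : Cochains h} (ha : a ∈ ⋀[ℂ]^i (Module.Dual ℂ h))
    (hb : b ∈ ⋀[ℂ]^j (Module.Dual ℂ h)) : a * b = (-1) ^ (i * j) * (b * a) := by
  induction ha using Submodule.pow_induction_on_left' with
  | algebraMap r => simp [Algebra.commutes]
  | add x y i hx hy ihx ihy => rw [mul_add, add_mul, ihx, ihy, mul_add]
  | mem_mul m hm i x hx ih =>
    obtain ⟨v, rfl⟩ := hm
    rw [mul_assoc, ih, Nat.succ_mul, pow_add]
    have h2 := ι_mul_comm h hb v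
    rcases neg_one_pow_eq_or (Cochains h) (i * j) with h1 | h1 <;>
    rcases neg_one_pow_eq_or (Cochains h) j with h3 | h3 <;> rw [h1, h3] <;> rw [h3] at h2 <;>
      simp only [one_mul, neg_mul, mul_neg, neg_neg, ← mul_assoc] at h2 ⊢ <;> rw [h2] <;> simp

variable [Module.Finite ℂ h]

/-- The differential in degree `1`, `dη(x, y) = -η([x, y])`, written in a basis `eᵢ` of `h` with
dual basis `eⁱ` as `dη = -½ ∑ᵢⱼ η([eᵢ, eⱼ]) eⁱ ∧ eʲ`. -/
noncomputable def d₁ : Module.Dual ℂ h →ₗ[ℂ] Cochains h :=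
  -(1 / 2 : ℂ) • ∑ i, ∑ j,
    (Module.Dual.eval ℂ h ⁅Module.finBasis ℂ h i, Module.finBasis ℂ h j⁆).smulRight
      (ExteriorAlgebra.ι ℂ ((Module.finBasis ℂ h).coord i) *
        ExteriorAlgebra.ι ℂ ((Module.finBasis ℂ h).coord j))

lemma d₁_apply (η : Module.Dual ℂ h) :
    d₁ h η = -(1 / 2 : ℂ) • ∑ i, ∑ j,
      η ⁅Module.finBasis ℂ h i, Module.finBasis ℂ h j⁆ •
        (ExteriorAlgebra.ι ℂ ((Module.finBasis ℂ h).coord i) *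
          ExteriorAlgebra.ι ℂ ((Module.finBasis ℂ h).coord j)) := by
  simp [d₁, LinearMap.sum_apply]

lemma d₁_mem (η : Module.Dual ℂ h) : d₁ h η ∈ ⋀[ℂ]^2 (Module.Dual ℂ h) := by
  rw [d₁_apply]
  refine Submodule.smul_mem _ _ (Submodule.sum_mem _ fun i _ => Submodule.sum_mem _ fun j _ =>
    Submodule.smul_mem _ _ ?_)
  rw [ExteriorAlgebra.exteriorPower, pow_two]
  exact Submodule.mul_mem_mul (LinearMap.mem_range_self _ _) (LinearMap.mem_range_self _ _)

/-- The map `v ↦ (-v, d₁ v; 0, v)` into upper triangular matrices. -/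
noncomputable def matι : Module.Dual ℂ h →ₗ[ℂ] Matrix (Fin 2) (Fin 2) (Cochains h) where
  toFun v := !![-ExteriorAlgebra.ι ℂ v, d₁ h v; 0, ExteriorAlgebra.ι ℂ v]
  map_add' v w := by ext i j; fin_cases i <;> fin_cases j <;> simp [add_comm]
  map_smul' r v := by ext i j; fin_cases i <;> fin_cases j <;> simp

lemma matι_sq (v : Module.Dual ℂ h) : matι h v * matι h v = 0 := by
  have := ι_mul_comm h (d₁_mem h v) v
  ext i j
  fin_cases i <;> fin_cases j <;> simp [matι, Matrix.mul_apply, Fin.sum_univ_two, this]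

/-- The algebra homomorphism `a ↦ (invol a, d a; 0, a)`, whose upper right entry encodes the unique
antiderivation `d` extending `d₁`. -/
noncomputable def mat : Cochains h →ₐ[ℂ] Matrix (Fin 2) (Fin 2) (Cochains h) :=
  ExteriorAlgebra.lift ℂ ⟨matι h, matι_sq h⟩

/-- The Chevalley-Eilenberg differential: the unique linear map which is equal to `d₁` on the dual
of `h` and satisfies `d (a b) = (d a) b + (-1) ^ n a (d b)` for `a` of degree `n`. -/
noncomputable def d : Cochains h →ₗ[ℂ] Cochains h where
  toFun a := mat h a 0 1
  map_add' a b := by simp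
  map_smul' r a := by simp

lemma mat_apply (a : Cochains h) : mat h a = !![invol h a, d h a; 0, a] := by
  have key : ∀ a, mat h a 0 0 = invol h a ∧ mat h a 1 0 = 0 ∧ mat h a 1 1 = a := by
    intro a
    induction a using ExteriorAlgebra.induction with
    | algebraMap r => simp [Matrix.algebraMap_matrix_apply]
    | ι v => simp [mat, matι, invol]
    | mul a b ha hb => simp [Matrix.mul_apply, Fin.sum_univ_two, ha, hb]
    | add a b ha hb => simp [ha, hb]
  obtain ⟨h1, h2, h3⟩ := key a
  ext i j
  fin_cases i <;> fin_cases j <;> simp [h1, h2, h3, d]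

lemma d_ι (v : Module.Dual ℂ h) : d h (ExteriorAlgebra.ι ℂ v) = d₁ h v := by
  simp [d, mat, matι]

lemma d_mul (a b : Cochains h) : d h (a * b) = d h a * b + invol h a * d h b := by
  have := congrFun (congrFun (map_mul (mat h) a b) 0) 1
  rw [mat_apply h a, mat_apply h b, mat_apply h (a * b)] at this
  simpa [Matrix.mul_apply, Fin.sum_univ_two, add_comm] using this

lemma leibniz {i : ℕ} {a : Cochains h} (b : Cochains h) (ha : a ∈ ⋀[ℂ]^i (Module.Dual ℂ h)) :
    d h (a * b) = d h a * b + (-1) ^ i * (a * d h b) := by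
  rw [d_mul, invol_mem h ha, mul_assoc]

lemma d_algebraMap (r : ℂ) : d h (algebraMap ℂ _ r) = 0 := by
  simp [d, Matrix.algebraMap_matrix_apply]

lemma d_mem {i : ℕ} {a : Cochains h} (ha : a ∈ ⋀[ℂ]^i (Module.Dual ℂ h)) :
    d h a ∈ ⋀[ℂ]^(i + 1) (Module.Dual ℂ h) := by
  induction ha using Submodule.pow_induction_on_left' with
  | algebraMap r => simp [d_algebraMap]
  | add x y i hx hy ihx ihy => rw [map_add]; exact add_mem ihx ihy
  | mem_mul m hm i x hx ih =>
    obtain ⟨v, rfl⟩ := hm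
    rw [d_mul, d_ι]
    refine add_mem ?_ ?_
    · have := Submodule.mul_mem_mul (d₁_mem h v) hx
      rwa [← pow_add, add_comm 2 i] at this
    · rw [invol, ExteriorAlgebra.map_apply_ι]
      have := Submodule.mul_mem_mul
        (LinearMap.mem_range_self (ExteriorAlgebra.ι ℂ) (-(LinearMap.id (R := ℂ)) v)) ih
      rwa [ExteriorAlgebra.exteriorPower, ← pow_succ'] at this

/-- Collapsing a basis expansion in the definition of `d₁`. -/
lemma sum_smul_d₁_coord (f : h →ₗ[ℂ] ℂ) :
    ∑ i, f (Module.finBasis ℂ h i) • d₁ h ((Module.finBasis ℂ h).coord i) = d₁ h f := by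
  simp_rw [← map_smul, ← map_sum]
  congr 1
  exact (Module.finBasis ℂ h).sum_dual_apply_smul_coord f

lemma sum_rotate {ι M : Type*} [Fintype ι] [AddCommMonoid M] (F : ι → ι → ι → M) :
    ∑ j, ∑ k, ∑ l, F k l j = ∑ j, ∑ k, ∑ l, F l j k := by
  rw [Finset.sum_comm (f := fun j k => ∑ l, F l j k)]
  exact Finset.sum_congr rfl fun j _ => Finset.sum_comm

lemma d_d₁ (η : Module.Dual ℂ h) : d h (d₁ h η) = 0 := by
  let e := Module.finBasis ℂ h
  let w : Fin (Module.finrank ℂ h) → Cochains h := fun i => ExteriorAlgebra.ι ℂ (e.coord i)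
  have hw : ∀ i j, w i * w j = -(w j * w i) := fun i j =>
    eq_neg_of_add_eq_zero_left (ExteriorAlgebra.ι_add_mul_swap (R := ℂ) _ _)
  have hcyc : ∀ k l j, w l * w j * w k = w k * w l * w j := by
    intro k l j
    rw [mul_assoc, hw j k, mul_neg, ← mul_assoc, hw l k, neg_mul, neg_neg]
  have hterm : ∀ i j, d h (w i * w j) = d₁ h (e.coord i) * w j - d₁ h (e.coord j) * w i := by
    intro i j
    have h1 := ι_mul_comm h (d₁_mem h (e.coord j)) (e.coord i)
    have h2 : invol h (w i) = -w i := by simp [invol, w]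
    rw [d_mul, h2, d_ι, d_ι, neg_mul, h1]
    simp [w, sub_eq_add_neg]
  have h1 : d h (d₁ h η) = -∑ j, ∑ i, η ⁅e i, e j⁆ • (d₁ h (e.coord i) * w j) := by
    have hs : ∑ i, ∑ j, η ⁅e i, e j⁆ • (d₁ h (e.coord j) * w i) =
        -∑ j, ∑ i, η ⁅e i, e j⁆ • (d₁ h (e.coord i) * w j) := by
      simp_rw [← Finset.sum_neg_distrib]
      refine Finset.sum_congr rfl fun i _ => Finset.sum_congr rfl fun j _ => ?_
      rw [← lie_skew, map_neg, neg_smul]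
    have hd : d h (d₁ h η) = -(1 / 2 : ℂ) • ∑ i, ∑ j, η ⁅e i, e j⁆ • d h (w i * w j) := by
      rw [d₁_apply, map_smul, map_sum]
      simp_rw [map_sum, map_smul]
      rfl
    rw [hd]
    simp_rw [hterm, smul_sub, Finset.sum_sub_distrib]
    rw [hs, Finset.sum_comm]
    module
  have h2 : ∀ j, ∑ i, η ⁅e i, e j⁆ • (d₁ h (e.coord i) * w j) =
      -(1 / 2 : ℂ) • ∑ k, ∑ l, η ⁅⁅e k, e l⁆, e j⁆ • (w k * w l * w j) := by
    intro j
    have h3 := sum_smul_d₁_coord h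
      (-(η ∘ₗ (LieModule.toEnd ℂ h h (e j) : h →ₗ[ℂ] h)))
    have h4 : ∀ x, (-(η ∘ₗ (LieModule.toEnd ℂ h h (e j) : h →ₗ[ℂ] h))) x = η ⁅x, e j⁆ := by
      intro x
      rw [← lie_skew x (e j), map_neg]
      rfl
    rw [d₁_apply] at h3
    simp_rw [h4] at h3
    have h5 := congrArg (· * w j) h3
    simp only [Finset.sum_mul, smul_mul_assoc] at h5
    exact h5
  have h6 : ∑ j, ∑ k, ∑ l, η ⁅⁅e k, e l⁆, e j⁆ • (w k * w l * w j) = 0 := by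
    set S := ∑ j, ∑ k, ∑ l, η ⁅⁅e k, e l⁆, e j⁆ • (w k * w l * w j) with hS
    have hS1 : S = ∑ j, ∑ k, ∑ l, η ⁅⁅e l, e j⁆, e k⁆ • (w k * w l * w j) := by
      rw [hS, sum_rotate fun k l j => η ⁅⁅e k, e l⁆, e j⁆ • (w k * w l * w j)]
      exact Finset.sum_congr rfl fun j _ => Finset.sum_congr rfl fun k _ =>
        Finset.sum_congr rfl fun l _ => by rw [hcyc]
    have hS2 : S = ∑ j, ∑ k, ∑ l, η ⁅⁅e j, e k⁆, e l⁆ • (w k * w l * w j) := by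
      rw [hS1, sum_rotate fun k l j => η ⁅⁅e l, e j⁆, e k⁆ • (w k * w l * w j)]
      exact Finset.sum_congr rfl fun j _ => Finset.sum_congr rfl fun k _ =>
        Finset.sum_congr rfl fun l _ => by rw [hcyc]
    have h3 : S + S + S = 0 := by
      have h9 : S + S + S = (∑ j, ∑ k, ∑ l, η ⁅⁅e k, e l⁆, e j⁆ • (w k * w l * w j)) +
          (∑ j, ∑ k, ∑ l, η ⁅⁅e l, e j⁆, e k⁆ • (w k * w l * w j)) +
          ∑ j, ∑ k, ∑ l, η ⁅⁅e j, e k⁆, e l⁆ • (w k * w l * w j) := by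
        rw [← hS1, ← hS2]
      rw [h9]
      simp only [← Finset.sum_add_distrib, ← add_smul, ← map_add]
      refine Finset.sum_eq_zero fun j _ => Finset.sum_eq_zero fun k _ =>
        Finset.sum_eq_zero fun l _ => ?_
      have := lie_jacobi (e k) (e l) (e j)
      have h7 : ⁅⁅e k, e l⁆, e j⁆ + ⁅⁅e l, e j⁆, e k⁆ + ⁅⁅e j, e k⁆, e l⁆ = 0 := by
        rw [← lie_skew ⁅e k, e l⁆ (e j), ← lie_skew ⁅e l, e j⁆ (e k), ← lie_skew ⁅e j, e k⁆ (e l),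
          ← neg_eq_zero, ← this]
        abel
      rw [h7, map_zero, zero_smul]
    have h8 : (3 : ℂ) • S = 0 := by rw [← h3]; module
    exact (smul_eq_zero.mp h8).resolve_left (by norm_num)
  rw [h1]
  simp_rw [h2]
  rw [← Finset.smul_sum, h6, smul_zero, neg_zero]

lemma d_d (a : Cochains h) : d h (d h a) = 0 := by
  have hinv : ∀ a, invol h (d h a) = - d h (invol h a) := by
    intro a
    induction a using ExteriorAlgebra.induction with
    | algebraMap r => simp [d_algebraMap]
    | ι v =>
      rw [d_ι, invol_mem h (d₁_mem h v)]
      simp [invol, d_ι]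
    | mul a b ha hb => simp only [d_mul, map_add, map_mul, ha, hb]; simp [add_comm]
    | add a b ha hb => simp only [map_add, ha, hb]; abel
  have hii : ∀ a, invol h (invol h a) = a := by
    intro a
    induction a using ExteriorAlgebra.induction with
    | algebraMap r => simp
    | ι v => simp [invol]
    | mul a b ha hb => simp [ha, hb]
    | add a b ha hb => simp [ha, hb]
  induction a using ExteriorAlgebra.induction with
  | algebraMap r => simp [d_algebraMap]
  | ι v => rw [d_ι, d_d₁]
  | mul a b ha hb => simp [d_mul, ha, hb, hinv]
  | add a b ha hb => simp [ha, hb]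

end ChevalleyEilenberg

open ChevalleyEilenberg in
/-- The Chevalley-Eilenberg cochain algebra of a finite-dimensional complex Lie algebra `h`. -/
noncomputable abbrev chevalleyEilenberg (h : Type u) [LieRing h] [LieAlgebra ℂ h]
    [Module.Finite ℂ h] : CDGA.{u} where
  carrier := ExteriorAlgebra ℂ (Module.Dual ℂ h)
  finite := Module.Finite.of_basis (Module.finBasis ℂ (Module.Dual ℂ h)).ExteriorAlgebra
  grading := fun i => ⋀[ℂ]^i (Module.Dual ℂ h)
  graded_comm := graded_comm h
  d := d h
  d_mem := d_mem h
  d_d := d_d h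
  leibniz := leibniz h
  connected := by rw [ExteriorAlgebra.exteriorPower, pow_zero, Submodule.one_eq_span]

/-- The variety of Lie algebra homomorphisms `h → g`, inside the space of linear maps. -/
def lieRep (h : Type u) (g : Type v) [LieRing h] [LieAlgebra ℂ h] [LieRing g] [LieAlgebra ℂ g] :
    Set (h →ₗ[ℂ] g) :=
  {φ | ∀ x y : h, φ ⁅x, y⁆ = ⁅φ x, φ y⁆}

/-- The Lie algebra homomorphisms `h → g` of rank at most `1`. -/
def lieRepRankOne (h : Type u) (g : Type v) [LieRing h] [LieAlgebra ℂ h] [LieRing g]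
    [LieAlgebra ℂ g] : Set (h →ₗ[ℂ] g) :=
  {φ | φ ∈ lieRep h g ∧ φ.rank ≤ 1}

/-! ### Brackets and the quadratic form `negDet` on `sl₂`. -/

namespace LieAlgebra.SpecialLinear

/-! The eigenvalues of `ad x` on `h` do not depend on `φ`, while those of `ad (φ x)` shrink as `φ`
tends to `0`. If `φ` is a homomorphism of rank at least two and `φ x` is not nilpotent, some `⁅φ x,
φ y⁆` is nonzero and is an eigenvector of `(ad (φ x)) ^ 2` with eigenvalue `4 * negDet (φ x)`. Since
`φ` intertwines `ad x` and `ad (φ x)`, this number is a nonzero root of the minimal polynomial of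
`(ad x) ^ 2` (`minpoly_eval_negDet`), so it lies in a finite set away from `0`. Hence `negDet (φ x)
= 0` for `φ` near `0`.

Imposing this for basis vectors and their pairwise sums makes the image of `φ` totally isotropic for
`negDet`, hence commutative. Centralizers of nonzero elements of `sl₂` are lines, so the rank is at
most one after all (`eventually_rank_le_one_of_mem_lieRep`).

For connections, the injective linear map `toHom` sends flat connections to homomorphisms, and any
`ω` with image a homomorphism of rank at most one lies in the rank one part. -/

/-- The quadratic form `-det` on `sl₂`. -/
def negDet (X : sl (Fin 2) ℂ) : ℂ := X.1 0 0 ^ 2 + X.1 0 1 * X.1 1 0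

lemma apply_one_one (X : sl (Fin 2) ℂ) : X.1 1 1 = -X.1 0 0 := by
  have h : Matrix.trace X.1 = 0 := X.2
  rw [Matrix.trace_fin_two] at h
  linear_combination h

lemma ext_fin_two {X Y : sl (Fin 2) ℂ} (h₀ : X.1 0 0 = Y.1 0 0) (h₁ : X.1 0 1 = Y.1 0 1)
    (h₂ : X.1 1 0 = Y.1 1 0) : X = Y := by
  apply Subtype.ext
  ext i j
  fin_cases i <;> fin_cases j
  · exact h₀
  · exact h₁
  · exact h₂
  · simpa [apply_one_one] using h₀

lemma lie_apply_zero_zero (X Y : sl (Fin 2) ℂ) :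
    (⁅X, Y⁆ : sl (Fin 2) ℂ).1 0 0 = X.1 0 1 * Y.1 1 0 - X.1 1 0 * Y.1 0 1 := by
  change (X.1 * Y.1 - Y.1 * X.1) 0 0 = _
  simp only [Matrix.sub_apply, Matrix.mul_apply, Fin.sum_univ_two]
  ring

lemma lie_apply_zero_one (X Y : sl (Fin 2) ℂ) :
    (⁅X, Y⁆ : sl (Fin 2) ℂ).1 0 1 = 2 * (X.1 0 0 * Y.1 0 1 - X.1 0 1 * Y.1 0 0) := by
  change (X.1 * Y.1 - Y.1 * X.1) 0 1 = _
  simp only [Matrix.sub_apply, Matrix.mul_apply, Fin.sum_univ_two, apply_one_one]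
  ring

lemma lie_apply_one_zero (X Y : sl (Fin 2) ℂ) :
    (⁅X, Y⁆ : sl (Fin 2) ℂ).1 1 0 = 2 * (X.1 1 0 * Y.1 0 0 - X.1 0 0 * Y.1 1 0) := by
  change (X.1 * Y.1 - Y.1 * X.1) 1 0 = _
  simp only [Matrix.sub_apply, Matrix.mul_apply, Fin.sum_univ_two, apply_one_one]
  ring

/-- The eigenvalues of `ad X` are `0` and `±2√(-det X)`, so Cayley–Hamilton reads `(ad X)³ = 4 (-det
X) ad X`. -/
lemma lie_lie_lie (X Y : sl (Fin 2) ℂ) : ⁅X, ⁅X, ⁅X, Y⁆⁆⁆ = (4 * negDet X) • ⁅X, Y⁆ := by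
  apply ext_fin_two <;>
  simp only [lie_apply_zero_zero, lie_apply_zero_one, lie_apply_one_zero, negDet,
    SetLike.val_smul, Matrix.smul_apply, smul_eq_mul] <;> ring

/-- Up to scalars, the entries of the bracket are the 2 × 2 minors of the coordinates of `X` and
`Y`. When they vanish, dividing by a nonzero coordinate of `X` gives the factor. -/
lemma exists_eq_smul_of_lie_eq_zero {X Y : sl (Fin 2) ℂ} (hX : X ≠ 0) (h : ⁅X, Y⁆ = 0) :
    ∃ c : ℂ, Y = c • X := by
  have h₀ := lie_apply_zero_zero X Y
  have h₁ := lie_apply_zero_one X Y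
  have h₂ := lie_apply_one_zero X Y
  simp only [h, ZeroMemClass.coe_zero, Matrix.zero_apply] at h₀ h₁ h₂
  by_cases ha : X.1 0 0 = 0
  · by_cases hb : X.1 0 1 = 0
    · have hc : X.1 1 0 ≠ 0 := fun hc => hX (ext_fin_two (by simpa) (by simpa) (by simpa))
      refine ⟨Y.1 1 0 / X.1 1 0, ext_fin_two ?_ ?_ ?_⟩ <;>
      simp only [SetLike.val_smul, Matrix.smul_apply, smul_eq_mul] <;> field_simp <;> grind
    · refine ⟨Y.1 0 1 / X.1 0 1, ext_fin_two ?_ ?_ ?_⟩ <;>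
      simp only [SetLike.val_smul, Matrix.smul_apply, smul_eq_mul] <;> field_simp <;> grind
  · refine ⟨Y.1 0 0 / X.1 0 0, ext_fin_two ?_ ?_ ?_⟩ <;>
      simp only [SetLike.val_smul, Matrix.smul_apply, smul_eq_mul] <;> field_simp <;> grind

/-- By polarization `X` and `Y` span a totally isotropic subspace of a nondegenerate quadratic space
of dimension three, so they are proportional. Concretely, the square of each minor is a combination
of `negDet X`, `negDet Y` and their polar form. -/
lemma lie_eq_zero_of_negDet_eq_zero {X Y : sl (Fin 2) ℂ} (hX : negDet X = 0) (hY : negDet Y = 0)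
    (hXY : negDet (X + Y) = 0) : ⁅X, Y⁆ = 0 := by
  simp only [negDet, AddMemClass.coe_add, Matrix.add_apply] at hX hY hXY
  have h₀ : (X.1 0 1 * Y.1 1 0 - X.1 1 0 * Y.1 0 1) ^ 2 = 0 := by
    linear_combination
      (hXY - hX - hY) * (X.1 0 1 * Y.1 1 0 + X.1 1 0 * Y.1 0 1 - 2 * X.1 0 0 * Y.1 0 0) +
        4 * Y.1 0 0 ^ 2 * hX - 4 * X.1 0 1 * X.1 1 0 * hY
  have h₁ : (X.1 0 0 * Y.1 0 1 - X.1 0 1 * Y.1 0 0) ^ 2 = 0 := by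
    linear_combination Y.1 0 1 ^ 2 * hX + X.1 0 1 ^ 2 * hY - X.1 0 1 * Y.1 0 1 * (hXY - hX - hY)
  have h₂ : (X.1 1 0 * Y.1 0 0 - X.1 0 0 * Y.1 1 0) ^ 2 = 0 := by
    linear_combination Y.1 1 0 ^ 2 * hX + X.1 1 0 ^ 2 * hY - X.1 1 0 * Y.1 1 0 * (hXY - hX - hY)
  rw [sq_eq_zero_iff] at h₀ h₁ h₂
  apply ext_fin_two <;>
  simp only [lie_apply_zero_zero, lie_apply_zero_one, lie_apply_one_zero, h₀, h₁, h₂,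
    ZeroMemClass.coe_zero, Matrix.zero_apply, mul_zero]

/-- If `negDet` vanishes on the image of a basis and of the sums of two basis vectors, then the
image consists of commuting elements. -/
lemma lie_apply_eq_zero_of_basis {ι h : Type*} [Fintype ι] [AddCommGroup h] [Module ℂ h]
    (b : Module.Basis ι ℂ h) (φ : h →ₗ[ℂ] sl (Fin 2) ℂ) (h₁ : ∀ i, negDet (φ (b i)) = 0)
    (h₂ : ∀ i j, negDet (φ (b i + b j)) = 0) (x y : h) : ⁅φ x, φ y⁆ = 0 := by
  rw [← b.sum_repr x, ← b.sum_repr y]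
  simp only [map_sum, map_smul, sum_lie, lie_sum, smul_lie,
    lie_smul]
  have hb : ∀ i j, ⁅φ (b i), φ (b j)⁆ = 0 := fun i j =>
    lie_eq_zero_of_negDet_eq_zero (h₁ i) (h₁ j) (by rw [← map_add]; exact h₂ i j)
  simp [hb]

lemma rank_le_one_of_lie_eq_zero {h : Type*} [AddCommGroup h] [Module ℂ h]
    {φ : h →ₗ[ℂ] sl (Fin 2) ℂ} {X : sl (Fin 2) ℂ} (hX : X ≠ 0) (hφ : ∀ y, ⁅X, φ y⁆ = 0) :
    φ.rank ≤ 1 := by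
  refine (rank_submodule_le_one_iff' _).2 ⟨X, ?_⟩
  rintro _ ⟨y, rfl⟩
  obtain ⟨c, hc⟩ := exists_eq_smul_of_lie_eq_zero hX (hφ y)
  exact Submodule.mem_span_singleton.2 ⟨c, hc.symm⟩

end LieAlgebra.SpecialLinear

/-! ### Continuity for the module topology. -/

section Topology

open Filter Topology

lemma tendsto_moduleTopology {M N : Type*} [AddCommGroup M] [Module ℂ M] [AddCommGroup N]
    [Module ℂ N] (f : M →ₗ[ℂ] N) :
    Tendsto f (@nhds M (moduleTopology ℂ M) 0) (@nhds N (moduleTopology ℂ N) 0) := by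
  let := moduleTopology ℂ M
  let := moduleTopology ℂ N
  have : IsModuleTopology ℂ M := ⟨rfl⟩
  have : IsModuleTopology ℂ N := ⟨rfl⟩
  have := IsModuleTopology.toContinuousAdd ℂ N
  simpa using (IsModuleTopology.continuous_of_linearMap f).tendsto 0

lemma tendsto_moduleTopology_complex {M : Type*} [AddCommGroup M] [Module ℂ M] (f : M →ₗ[ℂ] ℂ) :
    Tendsto f (@nhds M (moduleTopology ℂ M) 0) (𝓝 0) := by
  let := moduleTopology ℂ M
  have : IsModuleTopology ℂ M := ⟨rfl⟩
  simpa using (IsModuleTopology.continuous_of_linearMap f).tendsto 0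

open LieAlgebra.SpecialLinear

lemma tendsto_negDet_apply {h : Type*} [AddCommGroup h] [Module ℂ h] (x : h) :
    Tendsto (fun φ : h →ₗ[ℂ] sl (Fin 2) ℂ => negDet (φ x))
      (@nhds _ (moduleTopology ℂ (h →ₗ[ℂ] sl (Fin 2) ℂ)) 0) (𝓝 0) := by
  have key : ∀ i j, Tendsto (fun φ : h →ₗ[ℂ] sl (Fin 2) ℂ => (φ x).1 i j)
      (@nhds _ (moduleTopology ℂ (h →ₗ[ℂ] sl (Fin 2) ℂ)) 0) (𝓝 0) := fun i j =>
    tendsto_moduleTopology_complex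
      { toFun := fun φ : h →ₗ[ℂ] sl (Fin 2) ℂ => (φ x).1 i j
        map_add' := fun _ _ => rfl
        map_smul' := fun _ _ => rfl }
  simpa [negDet] using ((key 0 0).pow 2).add ((key 0 1).mul (key 1 0))

/-- An intertwiner of `S` and `T` intertwines every polynomial in them; this carries the minimal
polynomial of `(ad x) ^ 2` over to `(ad (φ x)) ^ 2`. -/
lemma map_aeval_apply {V W : Type*} [AddCommGroup V] [Module ℂ V] [AddCommGroup W] [Module ℂ W]
    {φ : V →ₗ[ℂ] W} {S : Module.End ℂ V} {T : Module.End ℂ W} (hφ : ∀ v, φ (S v) = T (φ v))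
    (p : Polynomial ℂ) (v : V) : φ (Polynomial.aeval S p v) = Polynomial.aeval T p (φ v) := by
  induction p using Polynomial.induction_on generalizing v with
  | C a => simp [Module.algebraMap_end_apply]
  | add p q hp hq => simp [hp, hq]
  | monomial n a ih =>
    rw [pow_succ, ← mul_assoc, map_mul _ _ Polynomial.X, map_mul _ _ Polynomial.X,
      Polynomial.aeval_X, Polynomial.aeval_X, Module.End.mul_apply, Module.End.mul_apply, ← hφ, ih]

/-! ### The spectral obstruction to small homomorphisms of rank at least two. -/

variable {h : Type*} [LieRing h] [LieAlgebra ℂ h]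

/-- For a Lie algebra homomorphism of rank at least two, the nonzero values `4 negDet (φ x)` are
eigenvalues of `(ad x) ^ 2`. -/
lemma minpoly_eval_negDet {φ : h →ₗ[ℂ] sl (Fin 2) ℂ} (hφ : φ ∈ lieRep h (sl (Fin 2) ℂ))
    (hr : ¬ φ.rank ≤ 1) {x : h} (hx : negDet (φ x) ≠ 0) :
    (minpoly ℂ (LieModule.toEnd ℂ h h x ^ 2)).eval (4 * negDet (φ x)) = 0 := by
  have hX : φ x ≠ 0 := fun h0 => hx (by simp [h0, negDet])
  obtain ⟨y, hy⟩ : ∃ y, ⁅φ x, φ y⁆ ≠ 0 := by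
    by_contra! hc
    exact hr (rank_le_one_of_lie_eq_zero hX hc)
  -- The polynomial is applied to `⁅x, y⁆`, not `y`: its image `⁅φ x, φ y⁆` is an eigenvector,
  -- whereas `φ y` need not be one.
  have h1 := map_aeval_apply (φ := φ) (S := LieModule.toEnd ℂ h h x ^ 2)
    (T := LieModule.toEnd ℂ (sl (Fin 2) ℂ) (sl (Fin 2) ℂ) (φ x) ^ 2)
    (fun v => by simp [pow_two, hφ x]) (minpoly ℂ (LieModule.toEnd ℂ h h x ^ 2)) ⁅x, y⁆
  have h2 : Module.End.HasEigenvector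
      (LieModule.toEnd ℂ (sl (Fin 2) ℂ) (sl (Fin 2) ℂ) (φ x) ^ 2) (4 * negDet (φ x))
      ⁅φ x, φ y⁆ := by
    refine ⟨Module.End.mem_eigenspace_iff.2 ?_, hy⟩
    simp only [pow_two, Module.End.mul_apply, LieModule.toEnd_apply_apply, lie_lie_lie]
  rw [minpoly.aeval, hφ x y, Module.End.aeval_apply_of_hasEigenvector h2, LinearMap.zero_apply,
    map_zero, eq_comm, smul_eq_zero] at h1
  exact h1.resolve_right hy

variable [Module.Finite ℂ h]

lemma eventually_negDet_apply_eq_zero (x : h) :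
    ∀ᶠ φ in @nhds _ (moduleTopology ℂ (h →ₗ[ℂ] sl (Fin 2) ℂ)) 0,
      φ ∈ lieRep h (sl (Fin 2) ℂ) → ¬ φ.rank ≤ 1 → negDet (φ x) = 0 := by
  set p := minpoly ℂ (LieModule.toEnd ℂ h h x ^ 2) with hp
  have hp0 : p ≠ 0 := minpoly.ne_zero (Algebra.IsIntegral.isIntegral _)
  -- The value `0` may itself be a root; it is removed so that the complement of this finite set is
  -- a neighbourhood of `0`.
  have hfin : {z : ℂ | z ≠ 0 ∧ p.eval (4 * z) = 0}.Finite := by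
    refine ((Polynomial.finite_setOfPred_isRoot hp0).preimage
      (mul_right_injective₀ (show (4 : ℂ) ≠ 0 by norm_num)).injOn).subset fun z hz => hz.2
  have hmem : {z : ℂ | z ≠ 0 ∧ p.eval (4 * z) = 0}ᶜ ∈ 𝓝 (0 : ℂ) :=
    hfin.isClosed.isOpen_compl.mem_nhds fun h0 => h0.1 rfl
  filter_upwards [tendsto_negDet_apply x hmem] with φ hφ hrep hr
  by_contra hx
  exact hφ ⟨hx, minpoly_eval_negDet hrep hr hx⟩

/-- Lie algebra homomorphisms to `sl₂` close to `0` have rank at most one. -/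
theorem eventually_rank_le_one_of_mem_lieRep :
    ∀ᶠ φ in @nhds _ (moduleTopology ℂ (h →ₗ[ℂ] sl (Fin 2) ℂ)) 0,
      φ ∈ lieRep h (sl (Fin 2) ℂ) → φ.rank ≤ 1 := by
  let b := Module.finBasis ℂ h
  -- The neighbourhood depends on the vector, so only finitely many vectors can be used; a quadratic
  -- form is determined by its values on these.
  filter_upwards [eventually_all.2 fun i => eventually_negDet_apply_eq_zero (b i),
    eventually_all.2 fun i => eventually_all.2 fun j =>
      eventually_negDet_apply_eq_zero (b i + b j)] with φ h₁ h₂ hφ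
  by_contra hr
  have h0 := lie_apply_eq_zero_of_basis b φ (fun i => h₁ i hφ hr) fun i j => h₂ i j hφ hr
  obtain ⟨x, hx⟩ : ∃ x, φ x ≠ 0 := by
    by_contra! hc
    rw [show φ = 0 from LinearMap.ext hc, LinearMap.rank_zero] at hr
    exact hr zero_le_one
  exact hr (rank_le_one_of_lie_eq_zero hx (h0 x))

lemma germAtZero_eq_of_subset {M : Type*} [AddCommGroup M] [Module ℂ M] {X Y : Set M}
    (hYX : Y ⊆ X) (hXY : ∀ᶠ m in @nhds M (moduleTopology ℂ M) 0, m ∈ X → m ∈ Y) :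
    germAtZero X = germAtZero Y :=
  Germ.coe_eq.2 <| hXY.mono fun _ hm => propext ⟨hm, fun hy => hYX hy⟩

end Topology
-- Flat connections as Lie algebra homomorphisms.
namespace ChevalleyEilenberg

open TensorProduct

variable (h : Type*) [LieRing h] [LieAlgebra ℂ h]

/-- Evaluation of the degree two part of a cochain at a pair of vectors. -/
noncomputable def evalTwo (x y : h) : Cochains h →ₗ[ℂ] ℂ :=
  ExteriorAlgebra.liftAlternating fun n =>
    match n with
    | 2 => Matrix.detRowAlternating.compLinearMap
        (LinearMap.pi ![Module.Dual.eval ℂ h x, Module.Dual.eval ℂ h y])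
    | _ => 0

lemma evalTwo_ι_mul_ι (x y : h) (α β : Module.Dual ℂ h) :
    evalTwo h x y (ExteriorAlgebra.ι ℂ α * ExteriorAlgebra.ι ℂ β) = α x * β y - α y * β x := by
  rw [evalTwo, ExteriorAlgebra.liftAlternating_ι_mul, ExteriorAlgebra.liftAlternating_ι]
  change Matrix.det (Matrix.of fun i =>
    LinearMap.pi ![Module.Dual.eval ℂ h x, Module.Dual.eval ℂ h y] (![α, β] i)) = _
  rw [Matrix.det_fin_two]
  simp

variable [Module.Finite ℂ h] (g : Type*) [LieRing g] [LieAlgebra ℂ g]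

/-- The linear map `A¹ ⊗ g → Hom(h, g)` for the Chevalley-Eilenberg algebra `A` of `h`. -/
noncomputable def toHom : (chevalleyEilenberg h).grading 1 ⊗[ℂ] g →ₗ[ℂ] (h →ₗ[ℂ] g) :=
  dualTensorHom ℂ h g ∘ₗ
    (ExteriorAlgebra.ιInv ∘ₗ ((chevalleyEilenberg h).grading 1).subtype).rTensor g

lemma exists_eq_ι (a : (chevalleyEilenberg h).grading 1) :
    ∃ α : Module.Dual ℂ h, (a : Cochains h) = ExteriorAlgebra.ι ℂ α := by
  have ha : (a : Cochains h) ∈ LinearMap.range (ExteriorAlgebra.ι ℂ (M := Module.Dual ℂ h)) ^ 1 :=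
    a.2
  rw [pow_one] at ha
  obtain ⟨α, hα⟩ := ha
  exact ⟨α, hα.symm⟩

/-- The degree one cochain attached to a linear form. -/
noncomputable def cochainOne : Module.Dual ℂ h →ₗ[ℂ] (chevalleyEilenberg h).grading 1 :=
  (ExteriorAlgebra.ι ℂ).codRestrict _ fun α => by
    change _ ∈ LinearMap.range (ExteriorAlgebra.ι ℂ (M := Module.Dual ℂ h)) ^ 1
    rw [pow_one]
    exact LinearMap.mem_range_self _ _

lemma coe_cochainOne (α : Module.Dual ℂ h) :
    (cochainOne h α : Cochains h) = ExteriorAlgebra.ι ℂ α := rfl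

lemma cochainOne_surjective : Function.Surjective (cochainOne h) := fun a => by
  obtain ⟨α, hα⟩ := exists_eq_ι h a
  exact ⟨α, Subtype.ext hα.symm⟩

lemma toHom_tmul (α : Module.Dual ℂ h) (x : g) (y : h) :
    toHom h g (cochainOne h α ⊗ₜ x) y = α y • x := by
  change ExteriorAlgebra.ιInv (ExteriorAlgebra.ι ℂ α) y • x = _
  rw [ExteriorAlgebra.ι_leftInverse]

/-- Expanding in a basis and its dual basis recovers `ω` from its values, which yields the
injectivity of `toHom`. -/
lemma eq_sum_toHom (ω : (chevalleyEilenberg h).grading 1 ⊗[ℂ] g) :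
    ω = ∑ i, cochainOne h ((Module.finBasis ℂ h).coord i) ⊗ₜ[ℂ]
      toHom h g ω (Module.finBasis ℂ h i) := by
  induction ω with
  | zero => simp
  | add a b ha hb =>
    simp only [map_add, LinearMap.add_apply, tmul_add, Finset.sum_add_distrib]
    rw [← ha, ← hb]
  | tmul a x =>
    obtain ⟨α, rfl⟩ := cochainOne_surjective h a
    have key : ∀ i, cochainOne h ((Module.finBasis ℂ h).coord i) ⊗ₜ[ℂ]
        toHom h g (cochainOne h α ⊗ₜ x) (Module.finBasis ℂ h i) =
        cochainOne h (α (Module.finBasis ℂ h i) • (Module.finBasis ℂ h).coord i) ⊗ₜ[ℂ] x :=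
      fun i => by rw [toHom_tmul, tmul_smul, map_smul, smul_tmul']
    rw [Finset.sum_congr rfl fun i _ => key i, ← sum_tmul, ← map_sum,
      (Module.finBasis ℂ h).sum_dual_apply_smul_coord]

lemma toHom_injective : Function.Injective (toHom h g) := fun ω ω' hω => by
  rw [eq_sum_toHom h g ω, eq_sum_toHom h g ω', hω]

/-- The factor `½` in `d₁` offsets the two equal contributions from antisymmetry of the wedge and of
the bracket. -/
lemma evalTwo_d₁ (x y : h) (η : Module.Dual ℂ h) : evalTwo h x y (d₁ h η) = -η ⁅x, y⁆ := by
  let e := Module.finBasis ℂ h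
  have key : ∀ x y : h, ∑ i, ∑ j, η ⁅e i, e j⁆ * (e.coord i x * e.coord j y) = η ⁅x, y⁆ := by
    intro x y
    conv_rhs => rw [← e.sum_repr x, ← e.sum_repr y]
    simp only [sum_lie, lie_sum, smul_lie, lie_smul, map_sum, map_smul, smul_eq_mul,
      Finset.mul_sum, Module.Basis.coord_apply]
    rw [Finset.sum_comm]
    exact Finset.sum_congr rfl fun i _ => Finset.sum_congr rfl fun j _ => by ring
  have key' : ∑ i, ∑ j, η ⁅e i, e j⁆ * (e.coord i y * e.coord j x) = -η ⁅x, y⁆ := by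
    rw [key y x, ← lie_skew, map_neg]
  rw [d₁_apply]
  simp only [map_smul, map_sum, evalTwo_ι_mul_ι, smul_eq_mul]
  have hs : ∀ i j, η ⁅e i, e j⁆ * (e.coord i x * e.coord j y - e.coord i y * e.coord j x) =
      η ⁅e i, e j⁆ * (e.coord i x * e.coord j y) -
        η ⁅e i, e j⁆ * (e.coord i y * e.coord j x) := fun i j => mul_sub _ _ _
  change -(1 / 2 : ℂ) * ∑ i, ∑ j,
    η ⁅e i, e j⁆ * (e.coord i x * e.coord j y - e.coord i y * e.coord j x) = _
  simp only [hs, Finset.sum_sub_distrib]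
  rw [key, key']
  ring

lemma evalTwo_rTensor_d (ω : (chevalleyEilenberg h).grading 1 ⊗[ℂ] g) (x y : h) :
    TensorProduct.lid ℂ g ((evalTwo h x y).rTensor g
      ((chevalleyEilenberg h).d.rTensor g ((chevalleyEilenberg h).incl g ω))) =
      -toHom h g ω ⁅x, y⁆ := by
  induction ω with
  | zero => simp
  | add a b ha hb => simp only [map_add, LinearMap.add_apply, ha, hb, neg_add]
  | tmul a v =>
    obtain ⟨α, rfl⟩ := cochainOne_surjective h a
    rw [toHom_tmul, CDGA.incl, LinearMap.rTensor_tmul, LinearMap.rTensor_tmul,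
      LinearMap.rTensor_tmul, Submodule.subtype_apply, coe_cochainOne, lid_tmul, d_ι, evalTwo_d₁,
      neg_smul]

/-- Stated for two connections because `[ω, ω]` is quadratic: bilinearity permits a separate
induction on each tensor. -/
lemma evalTwo_bracket (ω ω' : (chevalleyEilenberg h).grading 1 ⊗[ℂ] g) (x y : h) :
    TensorProduct.lid ℂ g ((evalTwo h x y).rTensor g
      ((chevalleyEilenberg h).bracket g ((chevalleyEilenberg h).incl g ω)
        ((chevalleyEilenberg h).incl g ω'))) =
      ⁅toHom h g ω x, toHom h g ω' y⁆ - ⁅toHom h g ω y, toHom h g ω' x⁆ := by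
  induction ω with
  | zero => simp
  | add a b ha hb =>
    simp only [map_add, LinearMap.add_apply, ha, hb, add_lie]
    abel
  | tmul a v =>
    induction ω' with
    | zero => simp
    | add a b ha hb =>
      simp only [map_add, LinearMap.add_apply, ha, hb, lie_add]
      abel
    | tmul b w =>
      obtain ⟨α, rfl⟩ := cochainOne_surjective h a
      obtain ⟨β, rfl⟩ := cochainOne_surjective h b
      rw [toHom_tmul, toHom_tmul, toHom_tmul, toHom_tmul, CDGA.incl, LinearMap.rTensor_tmul,
        LinearMap.rTensor_tmul, Submodule.subtype_apply, Submodule.subtype_apply, coe_cochainOne,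
        coe_cochainOne, CDGA.bracket, map₂_apply_tmul, map_tmul, LinearMap.rTensor_tmul, lid_tmul,
        LinearMap.mul_apply', evalTwo_ι_mul_ι]
      simp only [smul_lie, lie_smul, smul_smul, sub_smul, LieHom.coe_toLinearMap,
        LieModule.toEnd_apply_apply, mul_comm]

/-- The curvature of a connection evaluates to the failure of the associated linear map to be a
Lie algebra homomorphism. -/
lemma evalTwo_curvature (ω : (chevalleyEilenberg h).grading 1 ⊗[ℂ] g) (x y : h) :
    TensorProduct.lid ℂ g ((evalTwo h x y).rTensor g
      ((chevalleyEilenberg h).d.rTensor g ((chevalleyEilenberg h).incl g ω) +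
        (1 / 2 : ℂ) • (chevalleyEilenberg h).bracket g ((chevalleyEilenberg h).incl g ω)
          ((chevalleyEilenberg h).incl g ω))) =
      ⁅toHom h g ω x, toHom h g ω y⁆ - toHom h g ω ⁅x, y⁆ := by
  rw [map_add, map_add, map_smul, map_smul, evalTwo_rTensor_d, evalTwo_bracket,
    ← lie_skew (toHom h g ω y)]
  module

lemma toHom_mem_lieRep {ω : (chevalleyEilenberg h).grading 1 ⊗[ℂ] g}
    (hω : ω ∈ (chevalleyEilenberg h).flatConnections g) : toHom h g ω ∈ lieRep h g := by
  intro x y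
  have hω' : (chevalleyEilenberg h).d.rTensor g ((chevalleyEilenberg h).incl g ω) +
      (1 / 2 : ℂ) • (chevalleyEilenberg h).bracket g ((chevalleyEilenberg h).incl g ω)
        ((chevalleyEilenberg h).incl g ω) = 0 := hω
  rw [eq_comm, ← sub_eq_zero, ← evalTwo_curvature, hω', map_zero, map_zero]

lemma flatConnectionsRankOne_subset {A : CDGA} :
    A.flatConnectionsRankOne g ⊆ A.flatConnections g := by
  rintro _ ⟨η, x, hη, rfl⟩
  simp [CDGA.flatConnections, CDGA.incl, CDGA.bracket, hη]

lemma mem_flatConnectionsRankOne {ω : (chevalleyEilenberg h).grading 1 ⊗[ℂ] g}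
    (hω : toHom h g ω ∈ lieRepRankOne h g) :
    ω ∈ (chevalleyEilenberg h).flatConnectionsRankOne g := by
  obtain ⟨hrep, hr⟩ := hω
  obtain ⟨v, hv⟩ := (rank_submodule_le_one_iff' _).1 hr
  by_cases hv0 : v = 0
  -- The line `ℂ ∙ v` carries a coordinate only if `v ≠ 0`; here `ω = 0`.
  · refine ⟨0, 0, by simp, toHom_injective h g (LinearMap.ext fun y => ?_)⟩
    have := hv (LinearMap.mem_range_self _ y)
    simpa [hv0] using this
  let η : Module.Dual ℂ h := (LinearEquiv.coord ℂ g v hv0).toLinearMap ∘ₗ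
    (toHom h g ω).codRestrict (ℂ ∙ v) fun y => hv (LinearMap.mem_range_self _ y)
  have hη : ∀ y, toHom h g ω y = η y • v := fun y =>
    
    (LinearEquiv.coord_apply_smul ℂ g v hv0
      ⟨toHom h g ω y, hv (LinearMap.mem_range_self _ y)⟩).symm
  -- The image lies in the abelian line spanned by `v`, so `η` kills brackets, which makes it
  -- closed.
  have hη0 : ∀ x y, η ⁅x, y⁆ = 0 := fun x y => by
    have := hrep x y
    rw [hη, hη x, hη y, smul_lie, lie_smul, lie_self, smul_zero, smul_zero, smul_eq_zero] at this
    exact this.resolve_right hv0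
  refine ⟨cochainOne h η, v, ?_, toHom_injective h g (LinearMap.ext fun y => ?_)⟩
  · change d h (ExteriorAlgebra.ι ℂ η) = 0
    rw [d_ι, d₁_apply]
    simp [hη0]
  · rw [hη, toHom_tmul]

end ChevalleyEilenberg

open ChevalleyEilenberg in
theorem corollary4p8 (h : Type u) [LieRing h] [LieAlgebra ℂ h] [Module.Finite ℂ h] :
    germAtZero ((chevalleyEilenberg h).flatConnections (LieAlgebra.SpecialLinear.sl (Fin 2) ℂ)) =
        germAtZero
          ((chevalleyEilenberg h).flatConnectionsRankOne (LieAlgebra.SpecialLinear.sl (Fin 2) ℂ)) ∧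
      germAtZero (lieRep h (LieAlgebra.SpecialLinear.sl (Fin 2) ℂ)) =
        germAtZero (lieRepRankOne h (LieAlgebra.SpecialLinear.sl (Fin 2) ℂ)) := by
  refine ⟨germAtZero_eq_of_subset (flatConnectionsRankOne_subset _) ?_,
    germAtZero_eq_of_subset (fun _ hφ => hφ.1) ?_⟩
  -- Continuity of `toHom` pulls the neighbourhood in `Hom(h, sl₂)` back to one in `A¹ ⊗ sl₂`.
  · have hT := tendsto_moduleTopology
      (M := (chevalleyEilenberg h).grading 1 ⊗[ℂ] LieAlgebra.SpecialLinear.sl (Fin 2) ℂ)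
      (N := h →ₗ[ℂ] LieAlgebra.SpecialLinear.sl (Fin 2) ℂ) (toHom h (LieAlgebra.SpecialLinear.sl (Fin 2) ℂ))
    filter_upwards [hT.eventually eventually_rank_le_one_of_mem_lieRep] with ω hω hflat
    have hrep := toHom_mem_lieRep h _ hflat
    exact mem_flatConnectionsRankOne h _ ⟨hrep, hω hrep⟩
  · filter_upwards [eventually_rank_le_one_of_mem_lieRep] with φ hφ hrep
    exact ⟨hrep, hφ hrep⟩
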